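/- Let $\mathbb H$ be a separable real Hilbert space, let $X$ be a random element of $\mathbb H$, and let $X_1,\dots,X_n$ be independent random elements distributed as $X$. For $x\neq 0$ put $\theta(x)=x/\|x\|$, put $\theta(0)=0$, and let $u\otimes u$ be the operator $z\mapsto\langle u,z\rangle u$. Let $1\le k\le n$, let $t_{n,k}=\inf\{t\ge 0:\ \mathbb P(\|X\|\le t)\ge 1-k/n\}$ be the $(1-k/n)$-quantile of $\|X\|$, and assume that the distribution function of $\|X\|$ takes the value $1-k/n$ at some point of $[0,\infty)$, that is, $\mathbb P(\|X\|>t_{n,k})=k/n$ (this holds for instance if this distribution function is continuous). Let $$C_t=\mathbb E\big[\theta(X)\otimes\theta(X)\,\big|\,\|X\|>t\big],\qquad \widehat C_k=\frac1k\sum_{i=1}^k\theta(X_{(i)})\otimes\theta(X_{(i)}),$$ where $X_{(1)},\dots,X_{(n)}$ is the sample reordered so that $\|X_{(1)}\|\ge\dots\ge\|X_{(n)}\|$. Then for every $\delta\in(0,1)$, with probability at least $1-\delta$ (and then simultaneously for all ways of breaking ties in the ordering), $$\|\widehat C_k-C_{t_{n,k}}\|_{HS}\le\frac{1+4\sqrt{\log(2/\delta)}+\sqrt{8\log(4/\delta)}}{\sqrt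 k}+\frac{8\log(2/\delta)+4\log(4/\delta)}{3k},$$ where $\|T\|_{HS}=\big(\sum_i\|Te_i\|^2\big)^{1/2}$ for any orthonormal basis $(e_i)$ of $\mathbb H$ is the Hilbert–Schmidt norm. -/

import Mathlib

open MeasureTheory ProbabilityTheory

noncomputable section

namespace ExtremePCA

/-- The Hilbert–Schmidt norm `(∑ᵢ ‖T eᵢ‖²)^(1/2)` of a bounded operator, computed in a Hilbert basis
`(eᵢ)`, with value `∞` when `T` is not Hilbert–Schmidt. (It does not depend on the basis.) -/
def hsNorm {ι H : Type*} [NormedAddCommGroup H] [InnerProductSpace ℝ H]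
    (e : HilbertBasis ι ℝ H) (T : H →L[ℝ] H) : ENNReal :=
  (∑' i, ‖T (e i)‖ₑ ^ 2) ^ (1 / 2 : ℝ)

/-- The angle `x / ‖x‖` of a vector `x` (it is `0` at `x = 0`). -/
def angle {H : Type*} [NormedAddCommGroup H] [InnerProductSpace ℝ H] (x : H) : H :=
  ‖x‖⁻¹ • x

/-- The rank-one operator `θ(x) ⊗ θ(x) : z ↦ ⟪θ(x), z⟫ θ(x)`, where `θ(x)` is the angle of `x`. -/
def angleTensor {H : Type*} [NormedAddCommGroup H] [InnerProductSpace ℝ H] (x : H) : H →L[ℝ] H :=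
  InnerProductSpace.rankOne ℝ (angle x) (angle x)

/-- The quantile of order `p` of the nonnegative variable `‖X‖`:
`inf {t ≥ 0 : P(‖X‖ ≤ t) ≥ p}`. -/
def radialQuantile {Ω H : Type*} [MeasurableSpace Ω] [NormedAddCommGroup H]
    (P : Measure Ω) (X : Ω → H) (p : ℝ) : ℝ :=
  sInf {t : ℝ | 0 ≤ t ∧ p ≤ P.real {ω | ‖X ω‖ ≤ t}}

/-- The pre-asymptotic covariance operator `C_t = E[Θ ⊗ Θ | ‖X‖ > t]`, `Θ` the angle of `X`. -/
def preCov {Ω H : Type*} [MeasurableSpace Ω] [NormedAddCommGroup H] [InnerProductSpace ℝ H]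
    (P : Measure Ω) (X : Ω → H) (t : ℝ) : H →L[ℝ] H :=
  ∫ ω, angleTensor (X ω) ∂(P[|{ω | t < ‖X ω‖}])

/-- `σ` orders the sample `x` by nonincreasing norm: `‖x (σ 0)‖ ≥ ‖x (σ 1)‖ ≥ …`. -/
def IsRadialOrdering {H : Type*} [NormedAddCommGroup H] {n : ℕ}
    (x : Fin n → H) (σ : Equiv.Perm (Fin n)) : Prop :=
  Antitone fun i => ‖x (σ i)‖

/-- The empirical covariance `k⁻¹ ∑_{i ≤ k} Θ_(i) ⊗ Θ_(i)` of the angles of the first `k` points of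
the sample `x` in the order given by `σ`. -/
def empCov {H : Type*} [NormedAddCommGroup H] [InnerProductSpace ℝ H] {n : ℕ}
    (k : ℕ) (x : Fin n → H) (σ : Equiv.Perm (Fin n)) : H →L[ℝ] H :=
  (k : ℝ)⁻¹ • ∑ i ∈ Finset.univ.filter (fun i : Fin n => (i : ℕ) < k), angleTensor (x (σ i))

end ExtremePCA

end

open scoped RealInnerProductSpace ENNReal

/-! A Hilbert–Schmidt operator is determined by its columns `T (e i)`, and its Hilbert–Schmidt norm
is their norm in `lp (fun _ => H) 2`. So the estimate concerns averages of vectors of norm at most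
one in a separable Hilbert space.

Let `B` be the set where the norm exceeds the quantile, `S` the sum of the angle tensors of the
sample points in `B`, and `N` the number of these points. The top-`k` points and the points in `B`
are both initial segments of the ordered sample, so one contains the other, up to ties that do no
harm. Hence the two sums differ by at most `|N - k|` (`norm_sum_filter_sub_sum_indicator_le`).
Because `B` has probability exactly `k/n`, the means of `N` and `S` are `k` and `k C`, and each
summand has variance at most `k/n`. Bernstein's inequality (`measureReal_norm_sum_ge_le`), used once
for `N` and once for `S` with failure probability `δ/2` each, bounds both deviations by `√(2kL) +
2L/3`, where `L = log (4/δ)`. Dividing their sum by `k` gives a bound smaller than the stated one.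

Bernstein's inequality comes from Pinelis' method: `cosh ‖·‖` replaces the exponential, and adding
an independent centered vector `v` multiplies its mean by at most `E (exp ‖v‖ - ‖v‖)`. -/

/-! ### Bernstein's inequality in Hilbert space. -/

/-- The power series in `q` has nonnegative coefficients `1/(2n)!`, and each `q ^ n` is convex on
the half-line. -/
theorem Real.cosh_sqrt_convexOn : ConvexOn ℝ (Set.Ici 0) fun q : ℝ => Real.cosh √q := by
  refine ⟨convex_Ici 0, fun x hx y hy a b ha hb hab => ?_⟩
  have series : ∀ q : ℝ, 0 ≤ q → HasSum (fun n : ℕ => q ^ n / (2 * n).factorial) (Real.cosh √q) := by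
    intro q hq
    simpa [pow_mul, Real.sq_sqrt hq] using Real.hasSum_cosh √q
  have hxy : 0 ≤ a • x + b • y := (convex_Ici (0 : ℝ)) hx hy ha hb hab
  refine hasSum_le (fun n => ?_) (series _ hxy)
    (((series x hx).mul_left a).add ((series y hy).mul_left b))
  have h := (convexOn_pow (𝕜 := ℝ) n).2 hx hy ha hb hab
  simp only [smul_eq_mul] at h ⊢
  calc _ ≤ (a * x ^ n + b * y ^ n) / ((2 * n).factorial : ℝ) := by gcongr
    _ = _ := by ring

/-- With `c` the cosine of the angle between two vectors of norms `a` and `b`, the squared norm of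
their sum is a convex combination of the collinear cases `(a + b)²` and `(a - b)²`. -/
theorem Real.cosh_sqrt_add_le {a b c : ℝ} (hc : |c| ≤ 1) :
    Real.cosh √(a ^ 2 + b ^ 2 + 2 * a * b * c) ≤
      Real.cosh a * Real.cosh b + c * (Real.sinh a * Real.sinh b) := by
  obtain ⟨h1, h2⟩ := abs_le.1 hc
  have h := Real.cosh_sqrt_convexOn.2 (Set.mem_Ici.2 (sq_nonneg (a + b)))
    (Set.mem_Ici.2 (sq_nonneg (a - b))) (show 0 ≤ (1 + c) / 2 by linarith)
    (show 0 ≤ (1 - c) / 2 by linarith) (by ring)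
  simp only [smul_eq_mul, Real.sqrt_sq_eq_abs, Real.cosh_abs, Real.cosh_add, Real.cosh_sub] at h
  have e : (1 + c) / 2 * (a + b) ^ 2 + (1 - c) / 2 * (a - b) ^ 2 =
      a ^ 2 + b ^ 2 + 2 * a * b * c := by ring
  rw [e] at h
  linarith

/-- One step of Pinelis' induction: the inner product is linear in `v`, so it averages to zero when
`v` is centered and independent of `x`. -/
theorem cosh_norm_add_le {E : Type*} [NormedAddCommGroup E] [InnerProductSpace ℝ E] (x v : E) :
    Real.cosh ‖x + v‖ ≤ Real.cosh ‖x‖ * (Real.exp ‖v‖ - ‖v‖) +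
      ⟪(Real.sinh ‖x‖ / ‖x‖) • x, v⟫ := by
  have hsv := Real.self_le_sinh_iff.2 (norm_nonneg v)
  have hexp : Real.exp ‖v‖ = Real.cosh ‖v‖ + Real.sinh ‖v‖ := (Real.cosh_add_sinh _).symm
  rcases eq_or_ne x 0 with rfl | hx
  · rw [zero_add, norm_zero, Real.sinh_zero, zero_div, zero_smul, inner_zero_left, Real.cosh_zero,
      hexp]
    linarith
  rcases eq_or_ne v 0 with rfl | hv
  · simp
  have hx' : 0 < ‖x‖ := norm_pos_iff.2 hx
  have hv' : 0 < ‖v‖ := norm_pos_iff.2 hv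
  set c : ℝ := ⟪x, v⟫ / (‖x‖ * ‖v‖) with hcdef
  have hc : |c| ≤ 1 := abs_real_inner_div_norm_mul_norm_le_one x v
  have hin : ⟪x, v⟫ = ‖x‖ * ‖v‖ * c := by rw [hcdef]; field_simp
  have hn : ‖x + v‖ = √(‖x‖ ^ 2 + ‖v‖ ^ 2 + 2 * ‖x‖ * ‖v‖ * c) := by
    rw [← Real.sqrt_sq (norm_nonneg (x + v)), norm_add_sq_real, hin]
    congr 1; ring
  have hlin : ⟪(Real.sinh ‖x‖ / ‖x‖) • x, v⟫ = c * (Real.sinh ‖x‖ * ‖v‖) := by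
    rw [real_inner_smul_left, hin]; field_simp
  have hs0 : 0 ≤ Real.sinh ‖x‖ := Real.sinh_nonneg_iff.2 hx'.le
  have hsc : Real.sinh ‖x‖ ≤ Real.cosh ‖x‖ := (Real.sinh_lt_cosh _).le
  have h1 : c * Real.sinh ‖x‖ ≤ Real.cosh ‖x‖ :=
    (mul_le_of_le_one_left hs0 (abs_le.1 hc).2).trans hsc
  rw [hn, hlin, hexp]
  refine (Real.cosh_sqrt_add_le hc).trans ?_
  -- What remains is `c sinh ‖x‖ (sinh ‖v‖ - ‖v‖) ≤ cosh ‖x‖ (sinh ‖v‖ - ‖v‖)`.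
  nlinarith [mul_le_mul_of_nonneg_right h1 (sub_nonneg.2 hsv)]

theorem Nat.two_mul_three_pow_le_factorial (n : ℕ) : 2 * 3 ^ n ≤ (n + 2).factorial := by
  induction n with
  | zero => simp [Nat.factorial]
  | succ n ih =>
    rw [show n + 1 + 2 = (n + 2) + 1 by ring, Nat.factorial_succ, pow_succ]
    nlinarith

/-- Termwise comparison with a geometric series of ratio `x / 3`, from `2 * 3 ^ n ≤ (n + 2)!`. -/
theorem Real.exp_sub_one_sub_le_div {x : ℝ} (hx : 0 ≤ x) (hx3 : x < 3) :
    Real.exp x - 1 - x ≤ x ^ 2 / (2 * (1 - x / 3)) := by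
  have h1 : HasSum (fun n : ℕ => x ^ n / n.factorial) (Real.exp x) := by
    rw [Real.exp_eq_exp_ℝ]; exact NormedSpace.expSeries_div_hasSum_exp x
  have h2 := (hasSum_nat_add_iff' 2).2 h1
  have h3 := (hasSum_geometric_of_lt_one (r := x / 3) (by positivity) (by linarith)).mul_left
    (x ^ 2 / 2)
  have h4 := hasSum_le (fun n => ?_) h2 h3
  · simp only [Finset.sum_range_succ, Finset.sum_range_zero] at h4
    calc _ = Real.exp x - (0 + x ^ 0 / (Nat.factorial 0 : ℝ) + x ^ 1 / (Nat.factorial 1 : ℝ)) := by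
          simp; ring
      _ ≤ _ := h4
      _ = _ := by
          have : 1 - x / 3 ≠ 0 := by linarith
          field_simp
  · have : (2 * 3 ^ n : ℝ) ≤ ((n + 2).factorial : ℝ) := by
      exact_mod_cast Nat.two_mul_three_pow_le_factorial n
    calc x ^ (n + 2) / ((n + 2).factorial : ℝ) ≤ x ^ (n + 2) / (2 * 3 ^ n) := by gcongr
      _ = _ := by rw [div_pow, pow_add]; field_simp

theorem integrable_comp_norm_of_bound {Ω : Type*} [MeasurableSpace Ω] {P : Measure Ω}
    [IsProbabilityMeasure P] {E : Type*} [NormedAddCommGroup E] [MeasurableSpace E] [BorelSpace E]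
    {f : ℝ → ℝ} (hf : Continuous f) {Y : Ω → E}
    (hY : Measurable Y) {M : ℝ} (hM : ∀ ω, ‖Y ω‖ ≤ M) : Integrable (fun ω => f ‖Y ω‖) P := by
  obtain ⟨C, hC⟩ := (isCompact_Icc (a := (0 : ℝ)) (b := M)).exists_bound_of_continuousOn
    hf.continuousOn
  exact Integrable.of_bound (hf.measurable.comp hY.norm).aestronglyMeasurable C
    (Filter.Eventually.of_forall fun ω => hC _ ⟨norm_nonneg _, hM ω⟩)

theorem integral_exp_norm_sub_norm_le {Ω : Type*} [MeasurableSpace Ω] {P : Measure Ω}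
    [IsProbabilityMeasure P] {E : Type*} [NormedAddCommGroup E] [InnerProductSpace ℝ E]
    [MeasurableSpace E] [BorelSpace E]
    {Y : Ω → E} (hY : Measurable Y) {M v l : ℝ}
    (hM : ∀ ω, ‖Y ω‖ ≤ M) (hv : ∫ ω, ‖Y ω‖ ^ 2 ∂P ≤ v) (hl : 0 ≤ l) (hlM : l * M < 3) :
    ∫ ω, (Real.exp ‖l • Y ω‖ - ‖l • Y ω‖) ∂P ≤
      Real.exp (l ^ 2 * v / (2 * (1 - l * M / 3))) := by
  have hD : 0 < 2 * (1 - l * M / 3) := by linarith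
  have hb : ∀ ω, ‖l • Y ω‖ ≤ l * M := fun ω => by
    rw [norm_smul, Real.norm_of_nonneg hl]
    exact mul_le_mul_of_nonneg_left (hM ω) hl
  have hsq := integrable_comp_norm_of_bound (P := P) (continuous_pow 2) hY hM
  have hce : Continuous fun r : ℝ => Real.exp r - r := by fun_prop
  calc _ ≤ ∫ ω, (1 + l ^ 2 / (2 * (1 - l * M / 3)) * ‖Y ω‖ ^ 2) ∂P := by
        refine integral_mono (integrable_comp_norm_of_bound hce (hY.const_smul l) hb)
          ((integrable_const 1).add (hsq.const_mul _)) fun ω => ?_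
        have h := Real.exp_sub_one_sub_le_div (norm_nonneg (l • Y ω)) ((hb ω).trans_lt hlM)
        have h2 : ‖l • Y ω‖ ^ 2 / (2 * (1 - ‖l • Y ω‖ / 3)) ≤
            ‖l • Y ω‖ ^ 2 / (2 * (1 - l * M / 3)) := by
          have := hb ω
          gcongr
        have h3 : ‖l • Y ω‖ ^ 2 / (2 * (1 - l * M / 3)) =
            l ^ 2 / (2 * (1 - l * M / 3)) * ‖Y ω‖ ^ 2 := by
          rw [norm_smul, Real.norm_of_nonneg hl]; ring
        dsimp only
        linarith
    _ = 1 + l ^ 2 / (2 * (1 - l * M / 3)) * ∫ ω, ‖Y ω‖ ^ 2 ∂P := by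
        rw [integral_add (integrable_const 1) (hsq.const_mul _), integral_const_mul]
        simp
    _ ≤ 1 + l ^ 2 / (2 * (1 - l * M / 3)) * v := by gcongr
    _ ≤ _ := by
        have := Real.add_one_le_exp (l ^ 2 * v / (2 * (1 - l * M / 3)))
        rw [div_mul_eq_mul_div]
        linarith

section
variable {Ω : Type*} [MeasurableSpace Ω] {P : Measure Ω} [IsProbabilityMeasure P]
  {E : Type*} [NormedAddCommGroup E] [InnerProductSpace ℝ E] [CompleteSpace E]
  [SecondCountableTopology E] [MeasurableSpace E] [BorelSpace E]

theorem ProbabilityTheory.IndepFun.integral_inner_eq_zero {S Y : Ω → E} (h : IndepFun S Y P)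
    (hS : Measurable S) (hY : Measurable Y) {g : E → E} (hg : Measurable g) {C M : ℝ}
    (hC : ∀ ω, ‖g (S ω)‖ ≤ C) (hM : ∀ ω, ‖Y ω‖ ≤ M) (h0 : ∫ ω, Y ω ∂P = 0) :
    Integrable (fun ω => ⟪g (S ω), Y ω⟫) P ∧ ∫ ω, ⟪g (S ω), Y ω⟫ ∂P = 0 := by
  have hm : Measurable fun z : E × E => ⟪g z.1, z.2⟫ := by fun_prop
  have hi : Integrable (fun ω => ⟪g (S ω), Y ω⟫) P := by
    refine Integrable.of_bound (hm.comp (hS.prodMk hY)).aestronglyMeasurable (C * M)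
      (Filter.Eventually.of_forall fun ω => ?_)
    refine (norm_inner_le_norm _ _).trans ?_
    have := norm_nonneg (g (S ω))
    exact mul_le_mul (hC ω) (hM ω) (norm_nonneg _) (this.trans (hC ω))
  refine ⟨hi, ?_⟩
  have hlaw := h.map_prod_eq_prod_map_map hS.aemeasurable hY.aemeasurable
  have hi' : Integrable (fun z : E × E => ⟪g z.1, z.2⟫) ((P.map S).prod (P.map Y)) := by
    rw [← hlaw, integrable_map_measure hm.aestronglyMeasurable (hS.prodMk hY).aemeasurable]
    exact hi
  have : IsProbabilityMeasure (P.map S) := Measure.isProbabilityMeasure_map hS.aemeasurable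
  have : IsProbabilityMeasure (P.map Y) := Measure.isProbabilityMeasure_map hY.aemeasurable
  have hYi : Integrable (fun y => y) (P.map Y) := by
    rw [integrable_map_measure (by fun_prop) hY.aemeasurable]
    exact Integrable.of_bound hY.aestronglyMeasurable M (Filter.Eventually.of_forall hM)
  have hY0 : ∫ y, y ∂(P.map Y) = 0 := by
    rw [integral_map hY.aemeasurable (by fun_prop), h0]
  calc ∫ ω, ⟪g (S ω), Y ω⟫ ∂P = ∫ z, ⟪g z.1, z.2⟫ ∂(P.map fun ω => (S ω, Y ω)) :=
        (integral_map (hS.prodMk hY).aemeasurable hm.aestronglyMeasurable).symm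
    _ = ∫ x, ∫ y, ⟪g x, y⟫ ∂(P.map Y) ∂(P.map S) := by rw [hlaw, integral_prod _ hi']
    _ = 0 := by simp [integral_inner hYi, hY0]

/-- Pinelis' exponential bound for sums of independent centered vectors of a Hilbert space. -/
theorem integral_cosh_norm_sum_le {α : Type*} {Y : α → Ω → E} (hY : ∀ i, Measurable (Y i))
    (hind : iIndepFun Y P) {M : ℝ} (hM : ∀ i ω, ‖Y i ω‖ ≤ M) (h0 : ∀ i, ∫ ω, Y i ω ∂P = 0)
    (s : Finset α) :
    ∫ ω, Real.cosh ‖∑ i ∈ s, Y i ω‖ ∂P ≤ ∏ i ∈ s, ∫ ω, (Real.exp ‖Y i ω‖ - ‖Y i ω‖) ∂P := by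
  classical
  induction s using Finset.induction_on with
  | empty => simp
  | insert a s ha ih =>
    have hSm : Measurable fun ω => ∑ i ∈ s, Y i ω := by fun_prop
    have hSb : ∀ ω, ‖∑ i ∈ s, Y i ω‖ ≤ s.card • M := fun ω =>
      (norm_sum_le_of_le s fun i _ => hM i ω).trans_eq (Finset.sum_const _)
    have hIab : ∀ ω, ‖Y a ω + ∑ i ∈ s, Y i ω‖ ≤ M + s.card • M := fun ω =>
      (norm_add_le _ _).trans (add_le_add (hM a ω) (hSb ω))
    have hSY : IndepFun (fun ω => ∑ i ∈ s, Y i ω) (Y a) P := by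
      have := hind.indepFun_finsetSum_of_notMem hY ha
      convert this using 1
      ext ω; simp
    have hce : Continuous fun r : ℝ => Real.exp r - r := by fun_prop
    have hcosh := integrable_comp_norm_of_bound (P := P) Real.continuous_cosh hSm hSb
    have hexp := integrable_comp_norm_of_bound (P := P) hce (hY a) (hM a)
    have hmul : IndepFun (fun ω => Real.cosh ‖∑ i ∈ s, Y i ω‖)
        (fun ω => Real.exp ‖Y a ω‖ - ‖Y a ω‖) P :=
      hSY.comp (φ := fun x : E => Real.cosh ‖x‖) (ψ := fun x : E => Real.exp ‖x‖ - ‖x‖)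
        (Real.continuous_cosh.comp continuous_norm).measurable
        (hce.comp continuous_norm).measurable
    -- The vector paired with `Y a` has norm `sinh ‖x‖`, hence is bounded; centering and
    -- independence remove this term.
    obtain ⟨hin, hin0⟩ := hSY.integral_inner_eq_zero hSm (hY a)
      (g := fun x => (Real.sinh ‖x‖ / ‖x‖) • x)
      (by have := Real.continuous_sinh.measurable; fun_prop)
      (C := Real.sinh (s.card • M)) (M := M) (fun ω => by
        set x := ∑ i ∈ s, Y i ω
        have hs : 0 ≤ Real.sinh ‖x‖ := Real.sinh_nonneg_iff.2 (norm_nonneg _)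
        refine le_trans ?_ (Real.sinh_le_sinh.2 (hSb ω))
        rw [norm_smul, Real.norm_of_nonneg (by positivity)]
        rcases eq_or_ne x 0 with hx | hx
        · simp [hx]
        · rw [div_mul_cancel₀ _ (norm_ne_zero_iff.2 hx)]) (hM a) (h0 a)
    have hprod : Integrable (fun ω => Real.cosh ‖∑ i ∈ s, Y i ω‖ *
        (Real.exp ‖Y a ω‖ - ‖Y a ω‖)) P := hmul.integrable_mul hcosh hexp
    calc ∫ ω, Real.cosh ‖∑ i ∈ insert a s, Y i ω‖ ∂P
        ≤ ∫ ω, (Real.cosh ‖∑ i ∈ s, Y i ω‖ * (Real.exp ‖Y a ω‖ - ‖Y a ω‖) +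
            ⟪(Real.sinh ‖∑ i ∈ s, Y i ω‖ / ‖∑ i ∈ s, Y i ω‖) • ∑ i ∈ s, Y i ω, Y a ω⟫) ∂P := by
          simp only [Finset.sum_insert ha]
          refine integral_mono (integrable_comp_norm_of_bound Real.continuous_cosh
            ((hY a).add hSm) hIab) (hprod.add hin) fun ω => ?_
          dsimp only
          rw [add_comm (Y a ω)]
          exact cosh_norm_add_le _ _
      _ = (∫ ω, Real.cosh ‖∑ i ∈ s, Y i ω‖ ∂P) * ∫ ω, (Real.exp ‖Y a ω‖ - ‖Y a ω‖) ∂P := by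
          rw [integral_add hprod hin, hin0, add_zero]
          exact hmul.integral_fun_mul_eq_mul_integral hcosh.1 hexp.1
      _ ≤ _ := by
          rw [Finset.prod_insert ha, mul_comm]
          refine mul_le_mul_of_nonneg_left ih (integral_nonneg fun ω => ?_)
          have := Real.add_one_le_exp ‖Y a ω‖
          simp only [Pi.zero_apply]
          linarith

/-- Bernstein's inequality in a Hilbert space. -/
theorem measureReal_norm_sum_ge_le {α : Type*} [Fintype α] {Y : α → Ω → E}
    (hY : ∀ i, Measurable (Y i)) (hind : iIndepFun Y P) {M v V L : ℝ} (hM0 : 0 ≤ M)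
    (hM : ∀ i ω, ‖Y i ω‖ ≤ M)
    (h0 : ∀ i, ∫ ω, Y i ω ∂P = 0) (hv : ∀ i, ∫ ω, ‖Y i ω‖ ^ 2 ∂P ≤ v)
    (hV : Fintype.card α * v = V) (hVpos : 0 < V) (hL : 0 ≤ L) :
    P.real {ω | √(2 * V * L) + M / 3 * L ≤ ‖∑ i, Y i ω‖} ≤ 2 * Real.exp (-L) := by
  -- `r` is the optimal exponent in the Gaussian case `M = 0`. Below it is damped to `l`, so that `l
  -- * t` exceeds the exponent of the moment bound by exactly `L`.
  set r := √(2 * L / V) with hr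
  have hr0 : 0 ≤ r := Real.sqrt_nonneg _
  have hr2 : r ^ 2 * V = 2 * L := by
    rw [hr, Real.sq_sqrt (by positivity)]; field_simp
  have hrV : √(2 * V * L) = r * V := by
    rw [Real.sqrt_eq_iff_mul_self_eq (by positivity) (by positivity)]
    linear_combination -V * hr2
  have hq : 0 < 1 + M / 3 * r := by positivity
  set l := r / (1 + M / 3 * r) with hl
  have hl0 : 0 ≤ l := by positivity
  have hlM' : 1 - l * M / 3 = 1 / (1 + M / 3 * r) := by rw [hl]; field_simp; ring
  have hlM : l * M < 3 := by
    have : 0 < 1 - l * M / 3 := by rw [hlM']; positivity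
    linarith
  set t := √(2 * V * L) + M / 3 * L with ht
  have hlt : l * t = L + L / (1 + M / 3 * r) := by
    rw [ht, hrV, hl]; field_simp
    linear_combination 3 * hr2
  have hvar : l ^ 2 * V / (2 * (1 - l * M / 3)) = L / (1 + M / 3 * r) := by
    rw [hlM', hl]; field_simp
    linear_combination hr2
  have hYm : ∀ i, Measurable fun ω => l • Y i ω := fun i => (hY i).const_smul l
  have hYb : ∀ i ω, ‖l • Y i ω‖ ≤ l * M := fun i ω => by
    rw [norm_smul, Real.norm_of_nonneg hl0]
    exact mul_le_mul_of_nonneg_left (hM i ω) hl0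
  have hind' : iIndepFun (fun i ω => l • Y i ω) P :=
    hind.comp (fun _ y => l • y) fun _ => measurable_const_smul l
  have hmgf : ∫ ω, Real.cosh ‖∑ i, l • Y i ω‖ ∂P ≤ Real.exp (L / (1 + M / 3 * r)) := by
    refine (integral_cosh_norm_sum_le hYm hind' hYb
      (fun i => by rw [integral_smul, h0, smul_zero]) Finset.univ).trans ?_
    refine (Finset.prod_le_prod (fun i _ => integral_nonneg fun ω => ?_)
      fun i _ => integral_exp_norm_sub_norm_le (hY i) (hM i) (hv i) hl0 hlM).trans ?_
    · have := Real.add_one_le_exp ‖l • Y i ω‖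
      simp only [Pi.zero_apply]
      linarith
    · rw [Finset.prod_const, ← Real.exp_nat_mul, Finset.card_univ, ← hvar, ← hV]
      apply le_of_eq; congr 1; ring
  have hSb : ∀ ω, ‖∑ i, l • Y i ω‖ ≤ Finset.univ.card • (l * M) := fun ω =>
    (norm_sum_le_of_le Finset.univ fun i _ => hYb i ω).trans_eq (Finset.sum_const _)
  have hint := integrable_comp_norm_of_bound (P := P) Real.continuous_cosh
    (Finset.measurable_fun_sum Finset.univ fun i _ => hYm i) hSb
  -- The threshold uses `cosh y ≥ exp y / 2`, the source of the factor 2 in the tail bound.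
  have hmarkov := mul_meas_ge_le_integral_of_nonneg
    (Filter.Eventually.of_forall fun ω => (Real.cosh_pos _).le) hint (Real.exp (l * t) / 2)
  have hsub : P.real {ω | t ≤ ‖∑ i, Y i ω‖} ≤
      P.real {ω | Real.exp (l * t) / 2 ≤ Real.cosh ‖∑ i, l • Y i ω‖} := by
    refine measureReal_mono fun ω hω => ?_
    simp only [Set.mem_ofPred_eq] at hω ⊢
    rw [← Finset.smul_sum, norm_smul, Real.norm_of_nonneg hl0, Real.cosh_eq]
    have h1 : Real.exp (l * t) ≤ Real.exp (l * ‖∑ i, Y i ω‖) := by gcongr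
    have h2 := Real.exp_pos (-(l * ‖∑ i, Y i ω‖))
    linarith
  refine hsub.trans ?_
  set q := P.real {ω | Real.exp (l * t) / 2 ≤ Real.cosh ‖∑ i, l • Y i ω‖}
  have h1 := hmarkov.trans hmgf
  rw [hlt, Real.exp_add] at h1
  have hp := Real.exp_pos (L / (1 + M / 3 * r))
  have h2 : Real.exp L / 2 * q ≤ 1 := by
    refine le_of_mul_le_mul_right ?_ hp
    linarith
  rw [Real.exp_neg]
  have hpL := Real.exp_pos L
  rw [← div_eq_mul_inv, le_div_iff₀ hpL]
  linarith
end

/-! ### Hilbert–Schmidt operators as square-summable families of columns. -/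

/-- Orthonormal vectors are `√2` apart, so balls of radius `1/2` around them are disjoint.
Countability makes the column space separable, as Bernstein's inequality requires. -/
theorem Orthonormal.countable_of_separableSpace {ι H : Type*} [NormedAddCommGroup H]
    [InnerProductSpace ℝ H] [TopologicalSpace.SeparableSpace H] {v : ι → H}
    (hv : Orthonormal ℝ v) : Countable ι := by
  rw [← Set.countable_univ_iff]
  refine Set.PairwiseDisjoint.countable_of_isOpen (s := fun i => Metric.ball (v i) (1 / 2))
    (fun i _ j _ hij => ?_) (fun i _ => Metric.isOpen_ball)
    fun i _ => ⟨v i, Metric.mem_ball_self (by norm_num)⟩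
  refine Metric.ball_disjoint_ball ?_
  have h : dist (v i) (v j) ^ 2 = 2 := by
    rw [dist_eq_norm, norm_sub_sq_real, hv.1, hv.1, hv.2 hij]; norm_num
  nlinarith [dist_nonneg (x := v i) (y := v j)]

theorem lp.separableSpace {ι : Type*} [Countable ι] {E : ι → Type*}
    [∀ i, NormedAddCommGroup (E i)] [∀ i, NormedSpace ℝ (E i)]
    [∀ i, TopologicalSpace.SeparableSpace (E i)] {p : ℝ≥0∞} [Fact (1 ≤ p)] (hp : p ≠ ∞) :
    TopologicalSpace.SeparableSpace (lp E p) := by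
  classical
  have hsep : TopologicalSpace.IsSeparable (⋃ i, Set.range (lp.single (E := E) p i)) :=
    TopologicalSpace.IsSeparable.iUnion fun i =>
      TopologicalSpace.isSeparable_range (lp.isometry_single i).continuous
  rw [← TopologicalSpace.isSeparable_univ_iff]
  refine (hsep.span (R := ℝ)).closure.mono fun f _ => ?_
  refine mem_closure_of_tendsto (lp.hasSum_single hp f) (Filter.Eventually.of_forall fun s => ?_)
  exact Submodule.sum_mem _ fun i _ =>
    Submodule.subset_span (Set.mem_iUnion.2 ⟨i, Set.mem_range_self _⟩)

section
variable {ι H : Type*} [NormedAddCommGroup H] [InnerProductSpace ℝ H]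

/-- The coordinates `(⟪eᵢ, u⟫ v)ᵢ` in a Hilbert basis of the rank-one operator `z ↦ ⟪u, z⟫ v`. -/
noncomputable def HilbertBasis.tensor (e : HilbertBasis ι ℝ H) (u v : H) :
    lp (fun _ : ι => H) 2 :=
  ⟨fun i => e.repr u i • v, by
    refine memℓp_gen ?_
    simpa [norm_smul, mul_pow] using
      ((lp.memℓp (e.repr u)).summable (by simp)).mul_right (‖v‖ ^ 2)⟩

theorem HilbertBasis.tensor_apply (e : HilbertBasis ι ℝ H) (u v : H) (i : ι) :
    e.tensor u v i = ⟪u, e i⟫ • v := by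
  rw [real_inner_comm, ← e.repr_apply_apply]; rfl

theorem HilbertBasis.norm_tensor (e : HilbertBasis ι ℝ H) (u v : H) :
    ‖e.tensor u v‖ = ‖u‖ * ‖v‖ := by
  rw [← sq_eq_sq₀ (norm_nonneg _) (by positivity)]
  have h1 := lp.norm_rpow_eq_tsum (p := 2) (by simp) (e.repr u)
  have h2 := lp.norm_rpow_eq_tsum (p := 2) (by simp) (e.tensor u v)
  simp only [ENNReal.toReal_ofNat, Real.rpow_ofNat, LinearIsometryEquiv.norm_map] at h1 h2
  rw [h2, mul_pow, h1, ← tsum_mul_right]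
  refine tsum_congr fun i => ?_
  rw [← mul_pow, ← norm_smul]; rfl

theorem HilbertBasis.continuous_tensor_self (e : HilbertBasis ι ℝ H) :
    Continuous fun u : H => e.tensor u u := by
  have hl : ∀ u u' v, e.tensor (u - u') v = e.tensor u v - e.tensor u' v := fun u u' v => by
    refine lp.ext (funext fun i => ?_)
    rw [lp.coeFn_sub, Pi.sub_apply]
    simp only [tensor_apply, inner_sub_left, sub_smul]
  have hr : ∀ u v v', e.tensor u (v - v') = e.tensor u v - e.tensor u v' := fun u v v' => by
    refine lp.ext (funext fun i => ?_)
    rw [lp.coeFn_sub, Pi.sub_apply]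
    simp only [tensor_apply, smul_sub]
  refine continuous_iff_continuousAt.2 fun u => ?_
  rw [ContinuousAt, tendsto_iff_norm_sub_tendsto_zero]
  have hlim : Filter.Tendsto (fun v => ‖v - u‖ * ‖v‖ + ‖u‖ * ‖v - u‖) (nhds u) (nhds 0) := by
    have : Continuous fun v : H => ‖v - u‖ * ‖v‖ + ‖u‖ * ‖v - u‖ := by fun_prop
    simpa using this.tendsto u
  refine squeeze_zero (fun _ => norm_nonneg _) (fun v => ?_) hlim
  have h : e.tensor v v - e.tensor u u = e.tensor (v - u) v + e.tensor u (v - u) := by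
    rw [hl, hr]; abel
  rw [h]
  refine (norm_add_le _ _).trans_eq ?_
  rw [norm_tensor, norm_tensor]

theorem ExtremePCA.hsNorm_eq_enorm (e : HilbertBasis ι ℝ H) {T : H →L[ℝ] H}
    {w : lp (fun _ : ι => H) 2} (h : ∀ i, T (e i) = w i) : ExtremePCA.hsNorm e T = ‖w‖ₑ := by
  have hs : HasSum (fun i => ‖w i‖ ^ 2) (‖w‖ ^ 2) := by
    have := lp.hasSum_norm (p := 2) (by simp) w
    simpa using this
  have h1 : ∑' i, ‖T (e i)‖ₑ ^ 2 = ‖w‖ₑ ^ 2 := by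
    simp only [h, ← ofReal_norm, ← ENNReal.ofReal_pow (norm_nonneg _)]
    rw [← ENNReal.ofReal_tsum_of_nonneg (fun _ => by positivity) hs.summable, hs.tsum_eq]
  rw [ExtremePCA.hsNorm, h1, ← ENNReal.rpow_natCast, ← ENNReal.rpow_mul]
  norm_num

theorem ExtremePCA.norm_angle_le (x : H) : ‖ExtremePCA.angle x‖ ≤ 1 := by
  rw [ExtremePCA.angle, norm_smul, norm_inv, norm_norm]
  exact inv_mul_le_one

theorem ExtremePCA.measurable_angle [MeasurableSpace H] [BorelSpace H] :
    Measurable (ExtremePCA.angle : H → H) := by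
  unfold ExtremePCA.angle
  fun_prop
end

/-! ### Concentration of sums over exceedances, and comparison with the top `k` points. -/

theorem integral_norm_sub_integral_sq_le {Ω E : Type*} [MeasurableSpace Ω] {P : Measure Ω}
    [IsProbabilityMeasure P] [NormedAddCommGroup E] [InnerProductSpace ℝ E] [CompleteSpace E]
    {W : Ω → E} (hW : Integrable W P) (hW2 : Integrable (fun ω => ‖W ω‖ ^ 2) P) :
    ∫ ω, ‖W ω - ∫ ω', W ω' ∂P‖ ^ 2 ∂P ≤ ∫ ω, ‖W ω‖ ^ 2 ∂P := by
  set m := ∫ ω', W ω' ∂P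
  have hin : Integrable (fun ω => ⟪m, W ω⟫) P := hW.const_inner m
  have h : ∀ ω, ‖W ω - m‖ ^ 2 = ‖W ω‖ ^ 2 - 2 * ⟪m, W ω⟫ + ‖m‖ ^ 2 := fun ω => by
    rw [norm_sub_sq_real, real_inner_comm]
  have hsub : Integrable (fun ω => ‖W ω‖ ^ 2 - 2 * ⟪m, W ω⟫) P := hW2.sub (hin.const_mul 2)
  simp only [h]
  rw [integral_add hsub (integrable_const _),
    integral_sub hW2 (hin.const_mul 2), integral_const_mul, integral_inner hW,
    real_inner_self_eq_norm_sq]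
  simp only [integral_const, probReal_univ, smul_eq_mul, one_mul]
  linarith [sq_nonneg ‖m‖]

theorem measureReal_norm_sum_sub_ge_le {Ω H : Type*} [MeasurableSpace Ω] [MeasurableSpace H]
    {P : Measure Ω} [IsProbabilityMeasure P] {E : Type*} [NormedAddCommGroup E]
    [InnerProductSpace ℝ E] [CompleteSpace E] [SecondCountableTopology E] [MeasurableSpace E]
    [BorelSpace E] {n : ℕ} {κ : ℝ} (hκ : 0 < κ) (hn : n ≠ 0) {X : Ω → H} {Xs : Fin n → Ω → H}
    (hXs : ∀ i, Measurable (Xs i)) (hindep : iIndepFun Xs P)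
    (hident : ∀ i, IdentDistrib (Xs i) X P P) {B : Set H} (hB : MeasurableSet B)
    (hPB : P.real (X ⁻¹' B) = κ / n) {g : H → E} (hg : Measurable g)
    (hgB : ∀ x, ‖g x‖ ≤ B.indicator 1 x) {L : ℝ} (hL : 0 ≤ L) :
    P.real {ω | √(2 * κ * L) + 2 / 3 * L ≤
      ‖∑ i, g (Xs i ω) - (n : ℝ) • ∫ ω', g (X ω') ∂P‖} ≤ 2 * Real.exp (-L) := by
  have hg1 : ∀ x, ‖g x‖ ≤ 1 := fun x =>
    (hgB x).trans (Set.indicator_le' (fun _ _ => le_rfl) (fun _ _ => zero_le_one) x)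
  set m := ∫ ω', g (X ω') ∂P with hm
  have hi : ∀ i, Integrable (fun ω => g (Xs i ω)) P := fun i =>
    Integrable.of_bound (hg.comp (hXs i)).aestronglyMeasurable 1
      (Filter.Eventually.of_forall fun ω => hg1 _)
  have hmean : ∀ i, ∫ ω, g (Xs i ω) ∂P = m := fun i => ((hident i).comp hg).integral_eq
  have hm1 : ‖m‖ ≤ 1 := by
    simpa using norm_integral_le_of_norm_le_const (μ := P)
      (Filter.Eventually.of_forall fun ω => hg1 (X ω))
  have hsq : ∀ i, Integrable (fun ω => ‖g (Xs i ω)‖ ^ 2) P := fun i =>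
    integrable_comp_norm_of_bound (continuous_pow 2) (hg.comp (hXs i)) fun ω => hg1 _
  have hnR : (n : ℝ) ≠ 0 := by exact_mod_cast hn
  -- Centering at most doubles the bound 1, whence `M = 2`, and does not increase the second moment,
  -- which is at most `P(B) = κ / n` since `‖g‖² ≤ ‖g‖ ≤ 1_B`.
  have h := measureReal_norm_sum_ge_le (P := P) (Y := fun i ω => g (Xs i ω) - m) (M := 2)
    (v := κ / n) (V := κ) (L := L) (fun i => (hg.comp (hXs i)).sub_const m)
    (hindep.comp (fun _ x => g x - m) fun _ => hg.sub_const m) zero_le_two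
    (fun i ω => (norm_sub_le _ _).trans (by linarith [hg1 (Xs i ω)]))
    (fun i => by
      rw [integral_sub (hi i) (integrable_const m), hmean]
      simp)
    (fun i => by
      rw [← hmean i]
      refine (integral_norm_sub_integral_sq_le (hi i) (hsq i)).trans ?_
      have hBm : MeasurableSet (Xs i ⁻¹' B) := hXs i hB
      have hBi : P.real (Xs i ⁻¹' B) = κ / n := by
        rw [← hPB, measureReal_def, measureReal_def, (hident i).measure_mem_eq hB]
      rw [← hBi, ← integral_indicator_one hBm]
      refine integral_mono (hsq i) ((integrable_const 1).indicator hBm) fun ω => ?_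
      have h1 := hgB (Xs i ω)
      have h2 := hg1 (Xs i ω)
      calc ‖g (Xs i ω)‖ ^ 2 ≤ ‖g (Xs i ω)‖ := pow_le_of_le_one (norm_nonneg _) h2 two_ne_zero
        _ ≤ _ := h1)
    (by rw [Fintype.card_fin]; field_simp) hκ hL
  simpa only [Finset.sum_sub_distrib, Finset.sum_const, Finset.card_univ, Fintype.card_fin,
    ← Nat.cast_smul_eq_nsmul ℝ] using h

/-- Along the ordering, the indicators of "rank below `k`" and "norm above `t`" are both
nonincreasing, so their difference has constant sign and its `ℓ¹` norm is the absolute value of its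
sum. -/
theorem norm_sum_filter_sub_sum_indicator_le {H E : Type*} [NormedAddCommGroup H]
    [NormedAddCommGroup E] [NormedSpace ℝ E] {n k : ℕ} (hkn : k ≤ n) {x : Fin n → H}
    {σ : Equiv.Perm (Fin n)} (hσ : ExtremePCA.IsRadialOrdering x σ) (t : ℝ) {F : H → E}
    (hF : ∀ x, ‖F x‖ ≤ 1) :
    ‖∑ i ∈ Finset.univ.filter (fun i : Fin n => (i : ℕ) < k), F (x (σ i)) -
      ∑ i, {y : H | t < ‖y‖}.indicator F (x i)‖ ≤
    ‖∑ i, {y : H | t < ‖y‖}.indicator (1 : H → ℝ) (x i) - k‖ := by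
  classical
  set B := {y : H | t < ‖y‖} with hB
  set a : Fin n → ℝ := fun i => if (i : ℕ) < k then 1 else 0 with ha
  set b : Fin n → ℝ := fun i => B.indicator 1 (x (σ i)) with hb
  have hcard : ∑ i, a i = k := by
    simp only [ha, Finset.sum_boole]
    rw [Fin.card_filter_val_lt, min_eq_right hkn]
  have hsum : ∑ i, B.indicator (1 : H → ℝ) (x i) = ∑ i, b i :=
    (Equiv.sum_comp σ fun i => B.indicator (1 : H → ℝ) (x i)).symm
  have hdiff : ∑ i ∈ Finset.univ.filter (fun i : Fin n => (i : ℕ) < k), F (x (σ i)) -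
      ∑ i, B.indicator F (x i) = ∑ i, (a i - b i) • F (x (σ i)) := by
    rw [← Equiv.sum_comp σ fun i => B.indicator F (x i), Finset.sum_filter,
      ← Finset.sum_sub_distrib]
    refine Finset.sum_congr rfl fun i _ => ?_
    simp only [ha, hb, Set.indicator_apply, Pi.one_apply, sub_smul, ite_smul, one_smul, zero_smul]
  have hsign : (∀ i, a i ≤ b i) ∨ ∀ i, b i ≤ a i := by
    by_contra! h
    obtain ⟨⟨i, hi⟩, j, hj⟩ := h
    simp only [ha, hb, Set.indicator_apply, Pi.one_apply, hB, Set.mem_ofPred_eq] at hi hj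
    have hij : i < k ∧ ‖x (σ i)‖ ≤ t := by
      split_ifs at hi <;> constructor <;> linarith
    have hji : k ≤ j ∧ t < ‖x (σ j)‖ := by
      split_ifs at hj <;> constructor <;> linarith
    have := hσ (show i ≤ j from Fin.le_def.2 (by omega))
    simp only at this
    linarith [hij.2, hji.2]
  have habs : ∑ i, |a i - b i| = |∑ i, (a i - b i)| := by
    rcases hsign with h | h
    · rw [abs_of_nonpos (Finset.sum_nonpos fun i _ => sub_nonpos.2 (h i)), ← Finset.sum_neg_distrib]
      exact Finset.sum_congr rfl fun i _ => abs_of_nonpos (sub_nonpos.2 (h i))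
    · rw [abs_of_nonneg (Finset.sum_nonneg fun i _ => sub_nonneg.2 (h i))]
      exact Finset.sum_congr rfl fun i _ => abs_of_nonneg (sub_nonneg.2 (h i))
  rw [hdiff, hsum, ← hcard, norm_sub_rev, Real.norm_eq_abs, ← Finset.sum_sub_distrib, ← habs]
  refine norm_sum_le_of_le _ fun i _ => ?_
  rw [norm_smul, Real.norm_eq_abs]
  exact mul_le_of_le_one_right (abs_nonneg _) (hF _)

/-- An attained level is attained at the quantile: `≤` because the quantile is at most `s`, `≥` by
right continuity of the distribution function. -/
theorem ExtremePCA.measureReal_norm_le_radialQuantile {Ω H : Type*} [MeasurableSpace Ω]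
    [NormedAddCommGroup H] [MeasurableSpace H] [BorelSpace H] {P : Measure Ω}
    [IsProbabilityMeasure P] {X : Ω → H} (hX : Measurable X) {p s : ℝ} (hs : 0 ≤ s)
    (hp : P.real {ω | ‖X ω‖ ≤ s} = p) :
    P.real {ω | ‖X ω‖ ≤ ExtremePCA.radialQuantile P X p} = p := by
  set S := {t : ℝ | 0 ≤ t ∧ p ≤ P.real {ω | ‖X ω‖ ≤ t}} with hS
  have hsS : s ∈ S := ⟨hs, hp.ge⟩
  have hbdd : BddBelow S := ⟨0, fun _ h => h.1⟩
  set t := ExtremePCA.radialQuantile P X p with ht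
  have ht' : t = sInf S := rfl
  have hmono : ∀ a b : ℝ, a ≤ b → P.real {ω | ‖X ω‖ ≤ a} ≤ P.real {ω | ‖X ω‖ ≤ b} :=
    fun a b hab => measureReal_mono fun ω (h : ‖X ω‖ ≤ a) => h.trans hab
  refine le_antisymm ((hmono _ _ (csInf_le hbdd hsS)).trans_eq hp) ?_
  have hInter : {ω | ‖X ω‖ ≤ t} = ⋂ j : ℕ, {ω | ‖X ω‖ ≤ t + 1 / ((j : ℝ) + 1)} := by
    ext ω
    simp only [Set.mem_ofPred_eq, Set.mem_iInter]
    refine ⟨fun h j => h.trans (by simp; positivity), fun h => ?_⟩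
    have hlim : Filter.Tendsto (fun j : ℕ => t + 1 / ((j : ℝ) + 1)) Filter.atTop (nhds t) := by
      simpa using tendsto_one_div_add_atTop_nhds_zero_nat.const_add t
    exact ge_of_tendsto' hlim h
  have hanti : Antitone fun j : ℕ => {ω | ‖X ω‖ ≤ t + 1 / ((j : ℝ) + 1)} :=
    fun i j hij ω (h : ‖X ω‖ ≤ _) => h.trans (by gcongr)
  have hlim := tendsto_measure_iInter_atTop (μ := P)
    (fun j => (measurableSet_le hX.norm measurable_const).nullMeasurableSet) hanti
    ⟨0, measure_ne_top _ _⟩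
  rw [← hInter] at hlim
  refine ge_of_tendsto' ((ENNReal.tendsto_toReal (measure_ne_top _ _)).comp hlim) fun j => ?_
  obtain ⟨a, haS, ha⟩ := exists_lt_of_csInf_lt ⟨s, hsS⟩
    (show sInf S < t + 1 / ((j : ℝ) + 1) by rw [← ht']; simp; positivity)
  exact haS.2.trans (hmono _ _ ha.le)

/-! ### Columns of the angle tensors and of the two covariance operators. -/

section
variable {ι H : Type*} [NormedAddCommGroup H] [InnerProductSpace ℝ H]

/-- The coordinates of `θ(x) ⊗ θ(x)` in a Hilbert basis. -/
noncomputable def ExtremePCA.angleCoord (e : HilbertBasis ι ℝ H) (x : H) :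
    lp (fun _ : ι => H) 2 :=
  e.tensor (ExtremePCA.angle x) (ExtremePCA.angle x)

theorem ExtremePCA.norm_angleCoord_le (e : HilbertBasis ι ℝ H) (x : H) :
    ‖ExtremePCA.angleCoord e x‖ ≤ 1 := by
  rw [angleCoord, e.norm_tensor]
  exact mul_le_one₀ (norm_angle_le x) (norm_nonneg _) (norm_angle_le x)

theorem ExtremePCA.angleTensor_apply_basis (e : HilbertBasis ι ℝ H) (x : H) (i : ι) :
    ExtremePCA.angleTensor x (e i) = ExtremePCA.angleCoord e x i := by
  rw [angleCoord, e.tensor_apply, angleTensor, InnerProductSpace.rankOne_apply]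

theorem ExtremePCA.norm_angleTensor_le (x : H) : ‖ExtremePCA.angleTensor x‖ ≤ 1 := by
  refine ContinuousLinearMap.opNorm_le_bound _ zero_le_one fun z => ?_
  rw [angleTensor, InnerProductSpace.rankOne_apply, norm_smul]
  have h := norm_angle_le x
  calc _ ≤ (‖ExtremePCA.angle x‖ * ‖z‖) * ‖ExtremePCA.angle x‖ := by
        gcongr; exact norm_inner_le_norm _ _
    _ ≤ (1 * ‖z‖) * 1 := by gcongr
    _ = 1 * ‖z‖ := mul_one _

variable [TopologicalSpace.SeparableSpace H] [MeasurableSpace H] [BorelSpace H]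
  {Ω : Type*} [MeasurableSpace Ω]

theorem ExtremePCA.stronglyMeasurable_angleCoord (e : HilbertBasis ι ℝ H) :
    StronglyMeasurable (ExtremePCA.angleCoord e) :=
  have : SecondCountableTopology H := UniformSpace.secondCountable_of_separable H
  e.continuous_tensor_self.comp_stronglyMeasurable measurable_angle.stronglyMeasurable

theorem ExtremePCA.integrable_angleCoord (e : HilbertBasis ι ℝ H) {Q : Measure Ω}
    [IsFiniteMeasure Q] {X : Ω → H} (hX : Measurable X) :
    Integrable (fun ω => ExtremePCA.angleCoord e (X ω)) Q :=
  Integrable.of_bound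
    ((stronglyMeasurable_angleCoord e).comp_measurable hX).aestronglyMeasurable 1
    (Filter.Eventually.of_forall fun _ => norm_angleCoord_le e _)

theorem ExtremePCA.integrable_angleTensor {Q : Measure Ω} [IsFiniteMeasure Q] {X : Ω → H}
    (hX : Measurable X) : Integrable (fun ω => ExtremePCA.angleTensor (X ω)) Q := by
  have : SecondCountableTopology H := UniformSpace.secondCountable_of_separable H
  have hc : Continuous fun u : H => InnerProductSpace.rankOne ℝ u u :=
    (InnerProductSpace.rankOne ℝ).continuous.clm_apply continuous_id
  exact Integrable.of_bound
    (hc.comp_stronglyMeasurable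
      (measurable_angle.comp hX).stronglyMeasurable).aestronglyMeasurable 1
    (Filter.Eventually.of_forall fun _ => norm_angleTensor_le _)

variable [CompleteSpace H]

theorem ExtremePCA.preCov_apply_basis (e : HilbertBasis ι ℝ H) (P : Measure Ω)
    [IsFiniteMeasure P] {X : Ω → H} (hX : Measurable X) (t : ℝ) (i : ι) :
    ExtremePCA.preCov P X t (e i) =
      (∫ ω, ExtremePCA.angleCoord e (X ω) ∂(P[|{ω | t < ‖X ω‖}]) : lp (fun _ : ι => H) 2) i := by
  rw [preCov, ContinuousLinearMap.integral_apply (integrable_angleTensor hX)]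
  simp only [angleTensor_apply_basis e]
  exact (lp.evalCLM ℝ (fun _ : ι => H) 2 i).integral_comp_comm (integrable_angleCoord e hX)

theorem ExtremePCA.hsNorm_empCov_sub_preCov (e : HilbertBasis ι ℝ H) (P : Measure Ω)
    [IsFiniteMeasure P] {X : Ω → H} (hX : Measurable X) (t : ℝ) {n : ℕ} (k : ℕ) (x : Fin n → H)
    (σ : Equiv.Perm (Fin n)) :
    ExtremePCA.hsNorm e (ExtremePCA.empCov k x σ - ExtremePCA.preCov P X t) =
      ‖(k : ℝ)⁻¹ • ∑ i ∈ Finset.univ.filter (fun i : Fin n => (i : ℕ) < k),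
          ExtremePCA.angleCoord e (x (σ i)) -
        ∫ ω, ExtremePCA.angleCoord e (X ω) ∂(P[|{ω | t < ‖X ω‖}])‖ₑ := by
  refine hsNorm_eq_enorm e fun i => ?_
  rw [_root_.sub_apply, preCov_apply_basis e P hX, empCov, lp.coeFn_sub,
    Pi.sub_apply, lp.coeFn_smul, Pi.smul_apply, lp.coeFn_sum, Finset.sum_apply,
    _root_.smul_apply, _root_.sum_apply]
  simp only [angleTensor_apply_basis e]
end

/-! ### Assembling the bound. -/

theorem integral_cond_eq_smul_integral_indicator {Ω H E : Type*} [MeasurableSpace Ω]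
    [MeasurableSpace H] [NormedAddCommGroup E] [NormedSpace ℝ E] (P : Measure Ω) {X : Ω → H}
    (hX : Measurable X) {B : Set H} (hB : MeasurableSet B) (F : H → E) :
    ∫ ω, F (X ω) ∂(P[|X ⁻¹' B]) = (P.real (X ⁻¹' B))⁻¹ • ∫ ω, B.indicator F (X ω) ∂P := by
  have h : (fun ω => B.indicator F (X ω)) = (X ⁻¹' B).indicator fun ω => F (X ω) := rfl
  rw [h, integral_indicator (hX hB), ProbabilityTheory.cond, integral_smul_measure, ENNReal.toReal_inv,
    measureReal_def]

theorem inv_mul_two_mul_bernstein_le {κ δ : ℝ} (hκ : 0 < κ) (hδ0 : 0 < δ) (hδ1 : δ < 1) :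
    κ⁻¹ * (2 * (√(2 * κ * Real.log (4 / δ)) + 2 / 3 * Real.log (4 / δ))) ≤
      (1 + 4 * √(Real.log (2 / δ)) + √(8 * Real.log (4 / δ))) / √κ +
        (8 * Real.log (2 / δ) + 4 * Real.log (4 / δ)) / (3 * κ) := by
  have hL2 : 0 ≤ Real.log (2 / δ) := Real.log_nonneg ((one_le_div hδ0).2 (by linarith))
  set L := Real.log (4 / δ)
  have hs : 0 < √κ := Real.sqrt_pos.2 hκ
  have h8 : √(8 * L) = 2 * √(2 * L) := by
    rw [show 8 * L = 2 ^ 2 * (2 * L) by ring, Real.sqrt_mul (by norm_num),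
      Real.sqrt_sq (by norm_num)]
  have h1 : √(2 * κ * L) = √κ * √(2 * L) := by
    rw [← Real.sqrt_mul hκ.le]; congr 1; ring
  -- The left side is exactly the `log (4/δ)` part of the right side; the other terms are
  -- nonnegative slack.
  calc _ = √(8 * L) / √κ + 4 * L / (3 * κ) := by
        rw [h8, h1]
        nth_rewrite 1 [← Real.mul_self_sqrt hκ.le]
        field_simp
        linear_combination -4 * L * Real.sq_sqrt hκ.le
    _ ≤ _ := by
        gcongr
        · have := Real.sqrt_nonneg (Real.log (2 / δ))
          linarith
        · linarith

theorem mainTheorem2 {H : Type*} [NormedAddCommGroup H] [InnerProductSpace ℝ H] [CompleteSpace H]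
    [TopologicalSpace.SeparableSpace H] [MeasurableSpace H] [BorelSpace H]
    {ι : Type*} (e : HilbertBasis ι ℝ H)
    {Ω : Type*} [MeasurableSpace Ω] (P : Measure Ω) [IsProbabilityMeasure P]
    (n k : ℕ) (hk : 1 ≤ k) (hkn : k ≤ n)
    (X : Ω → H) (hX : Measurable X)
    (Xs : Fin n → Ω → H) (hXs : ∀ i, Measurable (Xs i))
    (hindep : iIndepFun Xs P) (hident : ∀ i, IdentDistrib (Xs i) X P P)
    (hlevel : ∃ s : ℝ, 0 ≤ s ∧ P.real {ω | ‖X ω‖ ≤ s} = 1 - (k : ℝ) / n)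
    (δ : ℝ) (hδ0 : 0 < δ) (hδ1 : δ < 1) :
    ∃ A : Set Ω, MeasurableSet A ∧ 1 - δ ≤ P.real A ∧
      ∀ ω ∈ A, ∀ σ : Equiv.Perm (Fin n), ExtremePCA.IsRadialOrdering (fun i => Xs i ω) σ →
        ExtremePCA.hsNorm e
            (ExtremePCA.empCov k (fun i => Xs i ω) σ -
              ExtremePCA.preCov P X (ExtremePCA.radialQuantile P X (1 - (k : ℝ) / n)))
          ≤ ENNReal.ofReal
              ((1 + 4 * √(Real.log (2 / δ)) + √(8 * Real.log (4 / δ))) / √k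
                + (8 * Real.log (2 / δ) + 4 * Real.log (4 / δ)) / (3 * k)) := by
  obtain ⟨s, hs, hs'⟩ := hlevel
  set t := ExtremePCA.radialQuantile P X (1 - (k : ℝ) / n)
  have hquant : P.real {ω | ‖X ω‖ ≤ t} = 1 - (k : ℝ) / n :=
    ExtremePCA.measureReal_norm_le_radialQuantile hX hs hs'
  have : Countable ι := e.orthonormal.countable_of_separableSpace
  have : TopologicalSpace.SeparableSpace (lp (fun _ : ι => H) 2) :=
    lp.separableSpace ENNReal.ofNat_ne_top
  have : SecondCountableTopology (lp (fun _ : ι => H) 2) :=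
    UniformSpace.secondCountable_of_separable _
  let : MeasurableSpace (lp (fun _ : ι => H) 2) := borel _
  have : BorelSpace (lp (fun _ : ι => H) 2) := ⟨rfl⟩
  have hκ : (0 : ℝ) < k := by exact_mod_cast hk
  have hn : n ≠ 0 := by omega
  have hnR : (n : ℝ) ≠ 0 := by exact_mod_cast hn
  set B : Set H := {y | t < ‖y‖} with hBdef
  have hB : MeasurableSet B := measurableSet_lt measurable_const measurable_norm
  have hPB : P.real (X ⁻¹' B) = k / n := by
    have hcompl : X ⁻¹' B = {ω | ‖X ω‖ ≤ t}ᶜ := by ext ω; simp [hBdef]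
    rw [hcompl, probReal_compl_eq_one_sub (measurableSet_le hX.norm measurable_const), hquant]
    ring
  set L := Real.log (4 / δ) with hLdef
  have hL : 0 ≤ L := Real.log_nonneg ((one_le_div hδ0).2 (by linarith))
  have hexpL : 2 * Real.exp (-L) = δ / 2 := by
    rw [hLdef, Real.exp_neg, Real.exp_log (by positivity)]; field_simp; norm_num
  set F := ExtremePCA.angleCoord e with hFdef
  have hF := ExtremePCA.norm_angleCoord_le e
  set r := √(2 * k * L) + 2 / 3 * L with hr
  have hGm : Measurable (B.indicator F) :=
    (ExtremePCA.stronglyMeasurable_angleCoord e).measurable.indicator hB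
  have h1m : Measurable (B.indicator (1 : H → ℝ)) := measurable_one.indicator hB
  have hTail1 := measureReal_norm_sum_sub_ge_le (P := P) hκ hn hXs hindep hident hB hPB hGm
    (fun x => by
      rw [norm_indicator_eq_indicator_norm]
      exact Set.indicator_le_indicator (hF x)) hL
  have hTail2 := measureReal_norm_sum_sub_ge_le (P := P) hκ hn hXs hindep hident hB hPB h1m
    (fun x => by
      rw [norm_indicator_eq_indicator_norm]
      exact Set.indicator_le_indicator (by simp)) hL
  -- The exact level `k/n` leaves no bias: the expected count is `k`, and below the expected sum is
  -- `k` times the conditional mean.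
  have hmean2 : (n : ℝ) • ∫ ω, B.indicator (1 : H → ℝ) (X ω) ∂P = k := by
    have : (fun ω => B.indicator (1 : H → ℝ) (X ω)) = (X ⁻¹' B).indicator 1 := rfl
    rw [this, integral_indicator_one (hX hB), hPB, smul_eq_mul]
    field_simp
  have hC := integral_cond_eq_smul_integral_indicator P hX hB F
  have hmean1 : (n : ℝ) • ∫ ω, B.indicator F (X ω) ∂P =
      (k : ℝ) • ∫ ω, F (X ω) ∂(P[|X ⁻¹' B]) := by
    rw [hC, hPB, smul_smul]
    congr 1
    field_simp
  rw [hexpL] at hTail1 hTail2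
  rw [hmean1] at hTail1
  rw [hmean2] at hTail2
  set C := ∫ ω, F (X ω) ∂(P[|X ⁻¹' B]) with hCdef
  have hm1 : Measurable fun ω => ‖∑ i, B.indicator F (Xs i ω) - (k : ℝ) • C‖ :=
    ((Finset.measurable_fun_sum _ fun i _ => hGm.comp (hXs i)).sub_const _).norm
  have hm2 : Measurable fun ω => ‖∑ i, B.indicator (1 : H → ℝ) (Xs i ω) - k‖ :=
    ((Finset.measurable_fun_sum _ fun i _ => h1m.comp (hXs i)).sub_const _).norm
  set D1 := {ω | r ≤ ‖∑ i, B.indicator F (Xs i ω) - (k : ℝ) • C‖}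
  set D2 := {ω | r ≤ ‖∑ i, B.indicator (1 : H → ℝ) (Xs i ω) - k‖}
  have hD : MeasurableSet (D1 ∪ D2) :=
    (measurableSet_le measurable_const hm1).union (measurableSet_le measurable_const hm2)
  refine ⟨(D1 ∪ D2)ᶜ, hD.compl, ?_, fun ω hω σ hσ => ?_⟩
  · rw [probReal_compl_eq_one_sub hD]
    have := measureReal_union_le (μ := P) D1 D2
    linarith
  obtain ⟨hω1, hω2⟩ : ω ∉ D1 ∧ ω ∉ D2 := by simpa [not_or] using hω
  have hω1' : ‖∑ i, B.indicator F (Xs i ω) - (k : ℝ) • C‖ < r := not_le.1 hω1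
  have hω2' : ‖∑ i, B.indicator (1 : H → ℝ) (Xs i ω) - k‖ < r := not_le.1 hω2
  have htop := norm_sum_filter_sub_sum_indicator_le hkn hσ t hF
  rw [ExtremePCA.hsNorm_empCov_sub_preCov e P hX, ← ofReal_norm]
  refine ENNReal.ofReal_le_ofReal (le_trans ?_ (inv_mul_two_mul_bernstein_le hκ hδ0 hδ1))
  change ‖(k : ℝ)⁻¹ • ∑ i ∈ Finset.univ.filter (fun i : Fin n => (i : ℕ) < k), F (Xs (σ i) ω) - C‖
    ≤ _
  set T := ∑ i ∈ Finset.univ.filter (fun i : Fin n => (i : ℕ) < k), F (Xs (σ i) ω)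
  set S := ∑ i, B.indicator F (Xs i ω)
  have hdecomp : (k : ℝ)⁻¹ • T - C = (k : ℝ)⁻¹ • ((T - S) + (S - (k : ℝ) • C)) := by
    rw [sub_add_sub_cancel, smul_sub, inv_smul_smul₀ hκ.ne']
  rw [hdecomp, norm_smul, Real.norm_of_nonneg (inv_nonneg.2 hκ.le)]
  refine mul_le_mul_of_nonneg_left ((norm_add_le _ _).trans ?_) (inv_nonneg.2 hκ.le)
  have h3 : ‖T - S‖ ≤ r := htop.trans hω2'.le
  linarith
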